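/- A monounary algebra is a pair $\mathfrak A=\langle A,f\rangle$ with $A$ a nonempty set and $f:A\to A$; it is connected if for all $a,b\in A$ there are $k,l\in\mathbb N$ with $f^k(a)=f^l(b)$. Every monounary algebra is, uniquely, a disjoint union of connected ones, its connected components. Let $\mathrm{MGen}(\mathfrak A)\in\mathbb N\cup\{\infty\}$ be the minimum number of generators of $\mathfrak A$ ($\infty$ if $\mathfrak A$ is not finitely generated). A subalgebra $\mathfrak A\subseteq\mathfrak B$ is large in $\mathfrak B$ if $\mathfrak B$ is generated by $A\cup\{b\}$ for some $b\in B$. For monounary algebras $\mathfrak A,\mathfrak B$, the generator distance $\mathrm d(\mathfrak A,\mathfrak B)\in\mathbb N\cup\{\infty\}$ is the least $l$ such that there is a finite sequence of monounary algebras from $\mathfrak A$ to $\mathfrak B$ in which any two consecutive members are either isomorphic, or joined by a step of the kind "one of the two is a large subalgebra of the other", with exactly $l$ steps of the latter kind being used; it is $\infty$ if there is no such sequence. **Theorem.** Let $1\le n\le m$ be natural numbers, let $\mathfrak A$ and $\mathfrak B$ be monounary algebras with exactly $n$ and exactly $m$ connected components, respectively, and let $\mathfrak A=\bigsqcup_{i<n}\mathfrak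 A_i$ and $\mathfrak B=\bigsqcup_{j<m}\mathfrak B_j$ be their decompositions into disjoint unions of connected monounary algebras. Then $$\mathrm d(\mathfrak A,\mathfrak B)=\min_{\pi\in S_m}\Bigl(\sum_{i<n}\mathrm d\bigl(\mathfrak A_i,\mathfrak B_{\pi(i)}\bigr)+\sum_{n\le k<m}\mathrm{MGen}\bigl(\mathfrak B_{\pi(k)}\bigr)\Bigr),$$ where $S_m$ is the set of permutations of $\{0,\dots,m-1\}$ and sums are taken in $\mathbb N\cup\{\infty\}$. -/

import Mathlib

universe u

/-- A monounary algebra `⟨A, f⟩`: a nonempty set with one unary operation. -/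
structure MonounaryAlgebra : Type (u + 1) where
  carrier : Type u
  nonempty_carrier : Nonempty carrier
  op : carrier → carrier

namespace MonounaryAlgebra

/-- A set of elements is closed under the operation. -/
def IsClosedSet (A : MonounaryAlgebra.{u}) (S : Set A.carrier) : Prop :=
  ∀ x ∈ S, A.op x ∈ S

/-- The universe of the subalgebra `⟨X⟩` generated by `X`: the least closed set containing `X`. -/
def gen (A : MonounaryAlgebra.{u}) (X : Set A.carrier) : Set A.carrier :=
  ⋂₀ {S | X ⊆ S ∧ A.IsClosedSet S}

/-- A (nonempty) subset of `B` closed under the operation, regarded as an algebra. -/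
def restrict (B : MonounaryAlgebra.{u}) (S : Set B.carrier) (hne : S.Nonempty)
    (hS : B.IsClosedSet S) : MonounaryAlgebra.{u} where
  carrier := S
  nonempty_carrier := hne.to_subtype
  op x := ⟨B.op x.1, hS x.1 x.2⟩

/-- `A` is a large subalgebra of `B`: it is the subalgebra of `B` carried by a subset `S`, and
`⟨S ∪ {b}⟩ = B` for some element `b` of `B`. -/
def IsLargeSubalgebra (A B : MonounaryAlgebra.{u}) : Prop :=
  ∃ (S : Set B.carrier) (hne : S.Nonempty) (hS : B.IsClosedSet S),
    A = B.restrict S hne hS ∧ ∃ b : B.carrier, B.gen (S ∪ {b}) = Set.univ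

/-- Isomorphism of monounary algebras. -/
def Isomorphic (A B : MonounaryAlgebra.{u}) : Prop :=
  ∃ e : A.carrier ≃ B.carrier, ∀ x, e (A.op x) = B.op (e x)

/-- `HasPath A B l`: in the network of large embeddings of the class of all monounary algebras
there is a path from `A` to `B` with exactly `l` blue edges. A red edge joins two isomorphic
algebras; a blue edge joins two algebras one of which is a large subalgebra of the other. -/
inductive HasPath (A : MonounaryAlgebra.{u}) : MonounaryAlgebra.{u} → ℕ → Prop
  | nil : HasPath A A 0
  | red {B C : MonounaryAlgebra.{u}} {l : ℕ} :
      HasPath A B l → Isomorphic B C → HasPath A C l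
  | blue {B C : MonounaryAlgebra.{u}} {l : ℕ} :
      HasPath A B l → (IsLargeSubalgebra B C ∨ IsLargeSubalgebra C B) → HasPath A C (l + 1)

/-- The generator distance: the least blue-length of a path from `A` to `B`, and `⊤` if there is
no path at all. -/
noncomputable def dist (A B : MonounaryAlgebra.{u}) : ℕ∞ :=
  ⨅ (l : ℕ) (_ : HasPath A B l), (l : ℕ∞)

/-- The minimum number of generators, `⊤` if the algebra is not finitely generated. -/
noncomputable def MGen (A : MonounaryAlgebra.{u}) : ℕ∞ :=
  ⨅ (X : Set A.carrier) (_ : A.gen X = Set.univ), X.encard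

/-- Connectedness: any two elements have a common iterate. -/
def IsConnected (A : MonounaryAlgebra.{u}) : Prop :=
  ∀ a b : A.carrier, ∃ k m : ℕ, A.op^[k] a = A.op^[m] b

/-- The disjoint union of a nonempty family of monounary algebras. -/
def disjointUnion {ι : Type} [Nonempty ι] (F : ι → MonounaryAlgebra.{u}) :
    MonounaryAlgebra.{u} where
  carrier := Σ i, (F i).carrier
  nonempty_carrier :=
    let ⟨i⟩ := ‹Nonempty ι›
    let ⟨x⟩ := (F i).nonempty_carrier
    ⟨⟨i, x⟩⟩
  op x := ⟨x.1, (F x.1).op x.2⟩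

end MonounaryAlgebra

/-!
Admitting the empty algebra makes the two kinds of summands uniform: the minimum number of
generators of an algebra is its distance from the empty one, and passing through the empty algebra
does not shorten distances, since `𝔄 → ∅ → 𝔅` can be replaced by `𝔄 → 𝔄 ⊔ 𝔅 → 𝔅`. So one may pad
the shorter family by empty systems and match two families with the same index set.

Changing one component at a time gives the upper bound. For the lower bound, follow the components
along a path: one large embedding changes a single component, possibly creating it, while the other
components are carried over isomorphically. Labels attached to the components of the first algebra,
with a fresh label for each new component, therefore split the path into paths between components
with equal labels, some of them empty. A component that dies and one that is born are then paired,
at no extra cost, by passing through the empty system.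
-/

section Matching

variable {ι α : Type*} {σ τ : ι ↪ α}

theorem exists_perm_forall_mem_range_apply_eq [Finite ι] (σ τ : ι ↪ α) :
    ∃ π : Equiv.Perm ι, ∀ i, σ i ∈ Set.range τ → τ (π i) = σ i := by
  have := Fintype.ofFinite ι
  have h : ∀ i, σ i ∈ Set.range τ → ∃ j, τ j = σ i := fun _ => id
  choose! g hg using h
  have hg_inj : Set.InjOn g {i | σ i ∈ Set.range τ} := fun i hi j hj hij =>
    σ.injective (by rw [← hg i hi, hij, hg j hj])
  obtain ⟨e, he⟩ := Set.MapsTo.exists_equiv_extend_of_card_eq (t := Finset.univ)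
    Finset.card_univ.symm (fun i _ => by simp) hg_inj
  exact ⟨e.trans (Equiv.subtypeUnivEquiv Finset.mem_univ), fun i hi =>
    (congrArg τ (he i hi)).trans (hg i hi)⟩

theorem apply_perm_mem_range_iff {π : Equiv.Perm ι}
    (hπ : ∀ i, σ i ∈ Set.range τ → τ (π i) = σ i) (i : ι) :
    τ (π i) ∈ Set.range σ ↔ τ (π i) = σ i := by
  refine ⟨fun ⟨j, hj⟩ => ?_, fun h => ⟨i, h.symm⟩⟩
  have hji : τ (π j) = τ (π i) := (hπ j ⟨π i, hj.symm⟩).trans hj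
  rw [← hj, π.injective (τ.injective hji)]

theorem sum_map_union_map [Fintype ι] {M : Type*} [AddCommMonoid M] [DecidableEq α]
    {π : Equiv.Perm ι} (hπ : ∀ i, σ i ∈ Set.range τ → τ (π i) = σ i) (c : α → M) :
    ∑ k ∈ Finset.univ.map σ ∪ Finset.univ.map τ, c k =
      ∑ i, (c (σ i) + if τ (π i) = σ i then 0 else c (τ (π i))) := by
  have hdiff : Finset.univ.map τ \ Finset.univ.map σ =
      (Finset.univ.filter fun i => τ (π i) ≠ σ i).map (π.toEmbedding.trans τ) := by
    ext k
    constructor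
    · intro hk
      obtain ⟨⟨j, rfl⟩, hj⟩ : k ∈ Set.range τ ∧ k ∉ Set.range σ := by simpa using hk
      obtain ⟨i, rfl⟩ := π.surjective j
      simpa using (apply_perm_mem_range_iff hπ i).not.1 hj
    · intro hk
      obtain ⟨i, hi, rfl⟩ : ∃ i, τ (π i) ≠ σ i ∧ τ (π i) = k := by simpa using hk
      simpa using (apply_perm_mem_range_iff hπ i).not.2 hi
  rw [← Finset.union_sdiff_self_eq_union, Finset.sum_union Finset.disjoint_sdiff, hdiff,
    Finset.sum_map, Finset.sum_map, Finset.sum_add_distrib, Finset.sum_filter]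
  simp only [ite_not, Function.Embedding.trans_apply, Equiv.coe_toEmbedding]

end Matching

/-- A possibly empty monounary algebra. -/
structure UnarySystem : Type (u + 1) where
  carrier : Type u
  op : carrier → carrier

namespace UnarySystem

open Function (Semiconj)

variable {X X' Y Y' Z : UnarySystem.{u}}

/-- Isomorphism of unary systems. -/
def Isomorphic (X Y : UnarySystem.{u}) : Prop :=
  ∃ e : X.carrier ≃ Y.carrier, Semiconj e X.op Y.op

namespace Isomorphic

theorem refl (X : UnarySystem.{u}) : Isomorphic X X := ⟨Equiv.refl _, fun _ => rfl⟩

theorem symm : Isomorphic X Y → Isomorphic Y X := fun ⟨e, he⟩ =>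
  ⟨e.symm, he.inverse_left e.left_inv e.right_inv⟩

theorem trans : Isomorphic X Y → Isomorphic Y Z → Isomorphic X Z := fun ⟨e, he⟩ ⟨f, hf⟩ =>
  ⟨e.trans f, he.trans hf⟩

theorem of_bijective {j : X.carrier → Y.carrier} (hj : Function.Bijective j)
    (hop : Semiconj j X.op Y.op) : Isomorphic X Y :=
  ⟨Equiv.ofBijective j hj, hop⟩

theorem of_isEmpty [IsEmpty X.carrier] [IsEmpty Y.carrier] : Isomorphic X Y :=
  ⟨Equiv.equivOfIsEmpty _ _, fun x => isEmptyElim x⟩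

end Isomorphic

/-- `j` embeds `X` into `Y`, and `Y` is generated by the image of `j` together with `b`: up to
isomorphism, `X` is a large subalgebra of `Y`. -/
structure IsLargeEmbedding (j : X.carrier → Y.carrier) (b : Y.carrier) : Prop where
  injective : Function.Injective j
  semiconj : Semiconj j X.op Y.op
  mem_range_or_iterate : ∀ y, y ∈ Set.range j ∨ ∃ k : ℕ, Y.op^[k] b = y

/-- `X` is isomorphic to a large subsystem of `Y`. -/
def EmbedsLargely (X Y : UnarySystem.{u}) : Prop :=
  ∃ (j : X.carrier → Y.carrier) (b : Y.carrier), IsLargeEmbedding j b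

/-- One of the two systems is isomorphic to a large subsystem of the other. -/
def Adjacent (X Y : UnarySystem.{u}) : Prop := EmbedsLargely X Y ∨ EmbedsLargely Y X

theorem EmbedsLargely.trans_isomorphic (h : EmbedsLargely X Y) (h' : Isomorphic Y Z) :
    EmbedsLargely X Z := by
  obtain ⟨j, b, hj⟩ := h
  obtain ⟨e, he⟩ := h'
  refine ⟨e ∘ j, e b, e.injective.comp hj.injective, hj.semiconj.trans he, fun z => ?_⟩
  obtain ⟨y, rfl⟩ := e.surjective z
  rcases hj.mem_range_or_iterate y with ⟨x, rfl⟩ | ⟨k, rfl⟩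
  · exact Or.inl ⟨x, rfl⟩
  · exact Or.inr ⟨k, (he.iterate_right k b).symm⟩

theorem Isomorphic.trans_embedsLargely (h : Isomorphic X Y) (h' : EmbedsLargely Y Z) :
    EmbedsLargely X Z := by
  obtain ⟨e, he⟩ := h
  obtain ⟨j, b, hj⟩ := h'
  refine ⟨j ∘ e, b, hj.injective.comp e.injective, he.trans hj.semiconj, ?_⟩
  rw [e.surjective.range_comp]
  exact hj.mem_range_or_iterate

theorem Adjacent.trans_isomorphic (h : Adjacent X Y) (h' : Isomorphic Y Z) : Adjacent X Z :=
  h.imp (·.trans_isomorphic h') h'.symm.trans_embedsLargely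

/-- `Path X Y l`: one can pass from `X` to `Y` by `l` steps between adjacent systems, all systems
being taken up to isomorphism. -/
inductive Path (X : UnarySystem.{u}) : UnarySystem.{u} → ℕ → Prop
  | iso {Y : UnarySystem.{u}} : Isomorphic X Y → Path X Y 0
  | step {Y Z : UnarySystem.{u}} {l : ℕ} : Path X Y l → Adjacent Y Z → Path X Z (l + 1)

namespace Path

theorem trans_isomorphic {l : ℕ} (h : Path X Y l) (h' : Isomorphic Y Z) : Path X Z l := by
  cases h with
  | iso h => exact .iso (h.trans h')
  | step h hadj => exact .step h (hadj.trans_isomorphic h')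

theorem trans {k l : ℕ} (h : Path X Y k) (h' : Path Y Z l) : Path X Z (k + l) := by
  induction h' with
  | iso h' => exact h.trans_isomorphic h'
  | step _ hadj ih => exact .step ih hadj

end Path

/-! ### The generator distance -/

/-- The generator distance in the network of possibly empty algebras. -/
noncomputable def dist (X Y : UnarySystem.{u}) : ℕ∞ :=
  ⨅ (l : ℕ) (_ : Path X Y l), (l : ℕ∞)

theorem Path.dist_le {l : ℕ} (h : Path X Y l) : dist X Y ≤ l :=
  iInf₂_le l h

theorem Isomorphic.dist_eq_zero (h : Isomorphic X Y) : dist X Y = 0 :=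
  nonpos_iff_eq_zero.1 (Path.iso h).dist_le

theorem Adjacent.dist_le_one (h : Adjacent X Y) : dist X Y ≤ 1 :=
  (Path.step (.iso (.refl X)) h).dist_le

theorem dist_triangle (X Y Z : UnarySystem.{u}) : dist X Z ≤ dist X Y + dist Y Z :=
  ENat.le_iInf₂_add_iInf₂ fun _ hk _ hl => mod_cast (hk.trans hl).dist_le

theorem Isomorphic.dist_congr (hX : Isomorphic X X') (hY : Isomorphic Y Y') :
    dist X Y = dist X' Y' := by
  have key : ∀ {X X' Y Y' : UnarySystem.{u}}, Isomorphic X X' → Isomorphic Y Y' →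
      dist X Y ≤ dist X' Y' := fun hX hY =>
    le_iInf₂ fun l h => by simpa using (((Path.iso hX).trans h).trans_isomorphic hY.symm).dist_le
  exact le_antisymm (key hX hY) (key hX.symm hY.symm)

/-! ### Disjoint unions -/

/-- The disjoint union of two unary systems. -/
def sum (X Y : UnarySystem.{u}) : UnarySystem.{u} where
  carrier := X.carrier ⊕ Y.carrier
  op := Sum.map X.op Y.op

instance (X Y : UnarySystem.{u}) [Nonempty Y.carrier] : Nonempty (X.sum Y).carrier :=
  inferInstanceAs (Nonempty (X.carrier ⊕ Y.carrier))

theorem sum_isomorphic_comm (X Y : UnarySystem.{u}) : Isomorphic (X.sum Y) (Y.sum X) :=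
  ⟨Equiv.sumComm _ _, by rintro (x | x) <;> rfl⟩

theorem isEmpty_sum_isomorphic (X Y : UnarySystem.{u}) [IsEmpty X.carrier] :
    Isomorphic (X.sum Y) Y :=
  ⟨Equiv.emptySum X.carrier Y.carrier, by rintro (x | x); exacts [isEmptyElim x, rfl]⟩

theorem Isomorphic.sum_right (h : Isomorphic X Y) (W : UnarySystem.{u}) :
    Isomorphic (X.sum W) (Y.sum W) := by
  obtain ⟨e, he⟩ := h
  refine ⟨Equiv.sumCongr e (Equiv.refl _), ?_⟩
  rintro (x | x)
  exacts [congrArg Sum.inl (he x), rfl]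

theorem EmbedsLargely.sum_right (h : EmbedsLargely X Y) (W : UnarySystem.{u}) :
    EmbedsLargely (X.sum W) (Y.sum W) := by
  obtain ⟨j, b, hj⟩ := h
  have hinl : Semiconj Sum.inl Y.op (Y.sum W).op := fun _ => rfl
  refine ⟨Sum.map j id, Sum.inl b, hj.injective.sumMap Function.injective_id, ?_, ?_⟩
  · rintro (x | x)
    exacts [congrArg Sum.inl (hj.semiconj x), rfl]
  · rintro (y | w)
    · rcases hj.mem_range_or_iterate y with ⟨x, rfl⟩ | ⟨k, rfl⟩
      · exact Or.inl ⟨Sum.inl x, rfl⟩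
      · exact Or.inr ⟨k, (hinl.iterate_right k b).symm⟩
    · exact Or.inl ⟨Sum.inr w, rfl⟩

theorem Adjacent.sum_right (h : Adjacent X Y) (W : UnarySystem.{u}) :
    Adjacent (X.sum W) (Y.sum W) :=
  h.imp (·.sum_right W) (·.sum_right W)

theorem Path.sum_right {l : ℕ} (h : Path X Y l) (W : UnarySystem.{u}) :
    Path (X.sum W) (Y.sum W) l := by
  induction h with
  | iso h => exact .iso (h.sum_right W)
  | step _ hadj ih => exact .step ih (hadj.sum_right W)

theorem dist_sum_right_le (X Y W : UnarySystem.{u}) : dist (X.sum W) (Y.sum W) ≤ dist X Y :=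
  le_iInf₂ fun _ h => (h.sum_right W).dist_le

theorem dist_sum_le (X X' Y Y' : UnarySystem.{u}) :
    dist (X.sum Y) (X'.sum Y') ≤ dist X X' + dist Y Y' := calc
  dist (X.sum Y) (X'.sum Y') ≤ dist (X.sum Y) (X'.sum Y) + dist (X'.sum Y) (X'.sum Y') :=
    dist_triangle _ _ _
  _ = dist (X.sum Y) (X'.sum Y) + dist (Y.sum X') (Y'.sum X') := by
    rw [(sum_isomorphic_comm X' Y).dist_congr (sum_isomorphic_comm X' Y')]
  _ ≤ dist X X' + dist Y Y' :=
    add_le_add (dist_sum_right_le X X' Y) (dist_sum_right_le Y Y' X')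

section Sigma

variable {ι κ : Type}

/-- The disjoint union of a family of unary systems. -/
def sigma (F : ι → UnarySystem.{u}) : UnarySystem.{u} where
  carrier := Σ i, (F i).carrier
  op x := ⟨x.1, (F x.1).op x.2⟩

theorem semiconj_sigma_mk (F : ι → UnarySystem.{u}) (i : ι) :
    Semiconj (Sigma.mk i) (F i).op (sigma F).op :=
  fun _ => rfl

theorem sigma_comp_equiv_isomorphic (F : κ → UnarySystem.{u}) (e : ι ≃ κ) :
    Isomorphic (sigma fun i => F (e i)) (sigma F) :=
  ⟨Equiv.sigmaCongrLeft (β := fun k => (F k).carrier) e, fun _ => rfl⟩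

theorem sigma_option_isomorphic (F : Option ι → UnarySystem.{u}) :
    Isomorphic (sigma F) ((F none).sum (sigma fun i => F (some i))) := by
  let j : (F none).carrier ⊕ (sigma fun i => F (some i)).carrier → (sigma F).carrier :=
    Sum.elim (fun x => ⟨none, x⟩) fun x => ⟨some x.1, x.2⟩
  refine (Isomorphic.of_bijective (j := j) ⟨?_, ?_⟩ ?_).symm
  · rintro (x | ⟨i, x⟩) (y | ⟨i', y⟩) h <;> cases h <;> rfl
  · rintro ⟨_ | i, x⟩
    exacts [⟨Sum.inl x, rfl⟩, ⟨Sum.inr ⟨i, x⟩, rfl⟩]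
  · rintro (x | x) <;> rfl

theorem dist_sigma_le [Fintype ι] (F G : ι → UnarySystem.{u}) :
    dist (sigma F) (sigma G) ≤ ∑ i, dist (F i) (G i) := by
  refine Fintype.induction_empty_option (P := fun ι _ => ∀ F G : ι → UnarySystem.{u},
    dist (sigma F) (sigma G) ≤ ∑ i, dist (F i) (G i)) ?_ ?_ ?_ ι F G
  · intro ι κ _ e ih F G
    let _ := Fintype.ofEquiv κ e.symm
    rw [← (sigma_comp_equiv_isomorphic F e).dist_congr (sigma_comp_equiv_isomorphic G e),
      ← e.sum_comp]
    exact ih _ _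
  · intro F G
    have (H : PEmpty → UnarySystem.{u}) : IsEmpty (sigma H).carrier :=
      inferInstanceAs (IsEmpty (Σ i, (H i).carrier))
    simp [Isomorphic.of_isEmpty.dist_eq_zero]
  · intro ι _ ih F G
    rw [(sigma_option_isomorphic F).dist_congr (sigma_option_isomorphic G), Fintype.sum_option]
    exact (dist_sum_le _ _ _ _).trans (add_le_add_right (ih _ _) _)

end Sigma

/-! ### Components and labels -/

/-- Two elements meet if they have a common iterate, i.e. lie in the same component. -/
def Meets (X : UnarySystem.{u}) (x y : X.carrier) : Prop := ∃ k l : ℕ, X.op^[k] x = X.op^[l] y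

namespace Meets

theorem symm {x y : X.carrier} : X.Meets x y → X.Meets y x :=
  fun ⟨k, l, h⟩ => ⟨l, k, h.symm⟩

theorem trans {x y z : X.carrier} : X.Meets x y → X.Meets y z → X.Meets x z := by
  rintro ⟨a, b, h⟩ ⟨c, d, h'⟩
  refine ⟨c + a, b + d, ?_⟩
  rw [Function.iterate_add_apply, h, Function.Commute.iterate_iterate_self, h',
    Function.iterate_add_apply]

theorem iterate_left (x : X.carrier) (k : ℕ) : X.Meets (X.op^[k] x) x := ⟨0, k, rfl⟩

theorem map {j : X.carrier → Y.carrier} (hop : Semiconj j X.op Y.op) {x y : X.carrier} :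
    X.Meets x y → Y.Meets (j x) (j y) := fun ⟨k, l, h⟩ =>
  ⟨k, l, by rw [← hop.iterate_right k, h, hop.iterate_right l]⟩

theorem of_map {j : X.carrier → Y.carrier} (hop : Semiconj j X.op Y.op)
    (hj : Function.Injective j) {x y : X.carrier} : Y.Meets (j x) (j y) → X.Meets x y :=
  fun ⟨k, l, h⟩ => ⟨k, l, hj (by rw [hop.iterate_right k, h, hop.iterate_right l])⟩

end Meets

/-- A unary system is preconnected if it is connected or empty. -/
def IsPreconnected (X : UnarySystem.{u}) : Prop := ∀ x y, X.Meets x y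

/-- A labelling of the elements of a unary system which is constant on components. -/
@[ext]
structure Labelling (X : UnarySystem.{u}) (α : Type*) where
  toFun : X.carrier → α
  map_op : ∀ x, toFun (X.op x) = toFun x

namespace Labelling

variable {α : Type*}

instance : CoeFun (X.Labelling α) fun _ => X.carrier → α := ⟨toFun⟩

theorem map_iterate (p : X.Labelling α) (k : ℕ) (x : X.carrier) : p (X.op^[k] x) = p x :=
  congrFun (Function.iterate_invariant (funext p.map_op) k) x

theorem eq_of_meets (p : X.Labelling α) {x y : X.carrier} : X.Meets x y → p x = p y := by
  rintro ⟨k, l, h⟩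
  rw [← p.map_iterate k x, h, p.map_iterate]

/-- The subsystem of the elements with label `i`. -/
def fiber (p : X.Labelling α) (i : α) : UnarySystem.{u} where
  carrier := {x // p x = i}
  op x := ⟨X.op x.1, (p.map_op _).trans x.2⟩

theorem sigma_fiber_isomorphic {κ : Type} (p : X.Labelling κ) : Isomorphic (sigma p.fiber) X :=
  ⟨Equiv.sigmaFiberEquiv p, fun _ => rfl⟩

/-- The pullback of a labelling along a homomorphism. -/
def comap (p : Y.Labelling α) {j : X.carrier → Y.carrier} (hop : Semiconj j X.op Y.op) :
    X.Labelling α where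
  toFun := p ∘ j
  map_op x := by rw [Function.comp_apply, hop x, p.map_op, Function.comp_apply]

/-- The nonempty fibers of the labelling are the components of `X`. Only finitely many labels are
used, so that fresh ones remain available when `X` is extended. -/
structure IsFaithful (p : X.Labelling α) : Prop where
  meets_of_eq : ∀ x y, p x = p y → X.Meets x y
  finite_range : (Set.range p).Finite

theorem IsFaithful.isPreconnected_fiber {p : X.Labelling α} (hp : p.IsFaithful) (i : α) :
    (p.fiber i).IsPreconnected := fun x y =>
  .of_map (X := p.fiber i) (Y := X) (j := Subtype.val) (fun _ => rfl) Subtype.val_injective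
    (hp.meets_of_eq x.1 y.1 (x.2.trans y.2.symm))

theorem IsFaithful.comap {p : Y.Labelling α} (hp : p.IsFaithful) {j : X.carrier → Y.carrier}
    (hop : Semiconj j X.op Y.op) (hj : Function.Injective j) : (p.comap hop).IsFaithful where
  meets_of_eq _ _ h := .of_map hop hj (hp.meets_of_eq _ _ h)
  finite_range := hp.finite_range.subset (Set.range_comp_subset_range j p)

theorem fiber_comap_isomorphic (p : Y.Labelling α) {j : X.carrier → Y.carrier}
    (hop : Semiconj j X.op Y.op) (hj : Function.Injective j) {i : α}
    (hi : ∀ y, p y = i → y ∈ Set.range j) : Isomorphic ((p.comap hop).fiber i) (p.fiber i) := by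
  refine .of_bijective (X := (p.comap hop).fiber i) (Y := p.fiber i)
    (j := fun x => ⟨j x.1, x.2⟩) ⟨fun x y h => ?_, ?_⟩ fun x => Subtype.ext (hop x.1)
  · exact Subtype.ext (hj (congrArg Subtype.val h))
  · rintro ⟨y, hy⟩
    obtain ⟨x, rfl⟩ := hi y hy
    exact ⟨⟨x, hy⟩, rfl⟩

end Labelling

namespace IsLargeEmbedding

variable {α : Type*} {j : X.carrier → Y.carrier} {b : Y.carrier}

theorem fiber_comap_embedsLargely (h : IsLargeEmbedding j b) (p : Y.Labelling α) :
    EmbedsLargely ((p.comap h.semiconj).fiber (p b)) (p.fiber (p b)) := by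
  have hval : Semiconj Subtype.val (p.fiber (p b)).op Y.op := fun _ => rfl
  refine ⟨fun x => ⟨j x.1, x.2⟩, ⟨b, rfl⟩, fun x y hxy => ?_,
    fun x => Subtype.ext (h.semiconj x.1), ?_⟩
  · exact Subtype.ext (h.injective (congrArg Subtype.val hxy))
  · rintro ⟨y, hy⟩
    rcases h.mem_range_or_iterate y with ⟨x, rfl⟩ | ⟨k, rfl⟩
    · exact Or.inl ⟨⟨x, hy⟩, rfl⟩
    · exact Or.inr ⟨k, Subtype.ext (hval.iterate_right k ⟨b, rfl⟩)⟩

theorem fiber_comap_isomorphic (h : IsLargeEmbedding j b) (p : Y.Labelling α) {i : α}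
    (hi : i ≠ p b) : Isomorphic ((p.comap h.semiconj).fiber i) (p.fiber i) := by
  refine p.fiber_comap_isomorphic h.semiconj h.injective fun y hy =>
    (h.mem_range_or_iterate y).resolve_right ?_
  rintro ⟨k, rfl⟩
  exact hi (hy.symm.trans (p.map_iterate k b))

theorem mem_range_or_meets (h : IsLargeEmbedding j b) (y : Y.carrier) :
    y ∈ Set.range j ∨ Y.Meets y b :=
  (h.mem_range_or_iterate y).imp_right fun ⟨k, hk⟩ => hk ▸ Meets.iterate_left b k

theorem exists_label_forall_eq_iff_meets [Infinite α] (h : IsLargeEmbedding j b)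
    {p : X.Labelling α} (hp : p.IsFaithful) : ∃ i₀, ∀ x, p x = i₀ ↔ Y.Meets (j x) b := by
  by_cases hb : ∃ x₀, Y.Meets (j x₀) b
  · obtain ⟨x₀, hx₀⟩ := hb
    exact ⟨p x₀, fun x => ⟨fun hx => ((hp.meets_of_eq _ _ hx).map h.semiconj).trans hx₀,
      fun hx => p.eq_of_meets (.of_map h.semiconj h.injective (hx.trans hx₀.symm))⟩⟩
  · obtain ⟨i₀, hi₀⟩ := hp.finite_range.exists_notMem
    exact ⟨i₀, fun x => ⟨fun hx => (hi₀ ⟨x, hx⟩).elim, fun hx => (hb ⟨x, hx⟩).elim⟩⟩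

theorem exists_extend_label [Infinite α] (h : IsLargeEmbedding j b) {p : X.Labelling α}
    (hp : p.IsFaithful) : ∃ (q : Y.carrier → α) (i₀ : α), (∀ x, q (j x) = p x) ∧
      (∀ y, Y.Meets y b → q y = i₀) ∧ ∀ x, p x = i₀ → Y.Meets (j x) b := by
  obtain ⟨i₀, hi₀⟩ := h.exists_label_forall_eq_iff_meets hp
  refine ⟨Function.extend j p fun _ => i₀, i₀, fun x => h.injective.extend_apply _ _ x,
    fun y hy => ?_, fun x => (hi₀ x).1⟩
  by_cases hyj : ∃ x, j x = y
  · obtain ⟨x, rfl⟩ := hyj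
    rwa [h.injective.extend_apply, hi₀]
  · exact Function.extend_apply' _ _ _ hyj

theorem exists_comap_eq [Infinite α] (h : IsLargeEmbedding j b) {p : X.Labelling α}
    (hp : p.IsFaithful) : ∃ q : Y.Labelling α, q.IsFaithful ∧ q.comap h.semiconj = p := by
  obtain ⟨q, i₀, hqj, hqb, hi₀⟩ := h.exists_extend_label hp
  have hq_op (y) : q (Y.op y) = q y := by
    rcases h.mem_range_or_meets y with ⟨x, rfl⟩ | hy
    · rw [← h.semiconj, hqj, hqj, p.map_op]
    · rw [hqb y hy, hqb (Y.op y) ((Meets.iterate_left y 1).trans hy)]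
  have hq_meets (y) (hy : q y = i₀) : Y.Meets y b := by
    rcases h.mem_range_or_meets y with ⟨x, rfl⟩ | hyb
    exacts [hi₀ x (hqj x ▸ hy), hyb]
  refine ⟨⟨q, hq_op⟩, ⟨fun y z (hyz : q y = q z) => ?_, ?_⟩, Labelling.ext (funext hqj)⟩
  · by_cases hz : q z = i₀
    · exact (hq_meets y (hyz.trans hz)).trans (hq_meets z hz).symm
    · obtain ⟨x, rfl⟩ := (h.mem_range_or_meets y).resolve_right fun hy => hz (hyz ▸ hqb y hy)
      obtain ⟨x', rfl⟩ := (h.mem_range_or_meets z).resolve_right fun hz' => hz (hqb z hz')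
      exact (hp.meets_of_eq x x' (by rwa [← hqj, ← hqj])).map h.semiconj
  · refine (hp.finite_range.insert i₀).subset ?_
    rintro _ ⟨y, rfl⟩
    rcases h.mem_range_or_meets y with ⟨x, rfl⟩ | hy
    exacts [Or.inr ⟨x, (hqj x).symm⟩, Or.inl (hqb y hy)]

end IsLargeEmbedding

section Tracking

variable {α : Type*} [Infinite α]

theorem Adjacent.exists_labelling (h : Adjacent X Y) {p : X.Labelling α} (hp : p.IsFaithful) :
    ∃ q : Y.Labelling α, q.IsFaithful ∧ ∃ i₀, Adjacent (p.fiber i₀) (q.fiber i₀) ∧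
      ∀ i ≠ i₀, Isomorphic (p.fiber i) (q.fiber i) := by
  rcases h with ⟨j, b, hj⟩ | ⟨j, b, hj⟩
  · obtain ⟨q, hq, rfl⟩ := hj.exists_comap_eq hp
    exact ⟨q, hq, q b, Or.inl (hj.fiber_comap_embedsLargely q),
      fun _ => hj.fiber_comap_isomorphic q⟩
  · exact ⟨p.comap hj.semiconj, hp.comap hj.semiconj hj.injective, p b,
      Or.inr (hj.fiber_comap_embedsLargely p), fun _ hi => (hj.fiber_comap_isomorphic p hi).symm⟩

theorem Adjacent.exists_labelling_sum_dist_fiber_le_one (h : Adjacent X Y) {p : X.Labelling α}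
    (hp : p.IsFaithful) : ∃ q : Y.Labelling α, q.IsFaithful ∧
      ∀ s : Finset α, ∑ i ∈ s, dist (p.fiber i) (q.fiber i) ≤ 1 := by
  classical
  obtain ⟨q, hq, i₀, hadj, hiso⟩ := h.exists_labelling hp
  refine ⟨q, hq, fun s => ?_⟩
  have hle (i : α) : dist (p.fiber i) (q.fiber i) ≤ if i = i₀ then 1 else 0 := by
    split_ifs with hi
    exacts [hi ▸ hadj.dist_le_one, (hiso i hi).dist_eq_zero.le]
  refine (Finset.sum_le_sum fun i _ => hle i).trans ?_
  rw [Finset.sum_ite_eq']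
  split_ifs
  exacts [le_rfl, zero_le_one]

theorem Path.exists_labelling_sum_dist_fiber_le {l : ℕ} (h : Path X Y l) {p : X.Labelling α}
    (hp : p.IsFaithful) : ∃ q : Y.Labelling α, q.IsFaithful ∧
      ∀ s : Finset α, ∑ i ∈ s, dist (p.fiber i) (q.fiber i) ≤ l := by
  induction h with
  | iso h =>
    obtain ⟨e, he⟩ := h.symm
    refine ⟨p.comap he, hp.comap he e.injective, fun s => ?_⟩
    refine (Finset.sum_eq_zero fun i _ => ?_).le
    exact (p.fiber_comap_isomorphic he e.injective fun x _ => e.surjective x).symm.dist_eq_zero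
  | step _ hadj ih =>
    obtain ⟨q, hq, hpq⟩ := ih
    obtain ⟨r, hr, hqr⟩ := hadj.exists_labelling_sum_dist_fiber_le_one hq
    refine ⟨r, hr, fun s => ?_⟩
    calc ∑ i ∈ s, dist (p.fiber i) (r.fiber i)
      _ ≤ ∑ i ∈ s, (dist (p.fiber i) (q.fiber i) + dist (q.fiber i) (r.fiber i)) :=
        Finset.sum_le_sum fun _ _ => dist_triangle _ _ _
      _ ≤ _ := by
        rw [Finset.sum_add_distrib, Nat.cast_succ]
        exact add_le_add (hpq s) (hqr s)

end Tracking

/-! ### Matching the components of two disjoint unions -/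

section Index

variable {ι : Type} {α : Type*}

/-- The labelling of a disjoint union by the relabelled indices of its members. -/
def indexLabelling (F : ι → UnarySystem.{u}) (f : ι → α) : (sigma F).Labelling α where
  toFun x := f x.1
  map_op _ := rfl

variable {F G : ι → UnarySystem.{u}}

theorem isFaithful_indexLabelling [Finite ι] (hF : ∀ i, (F i).IsPreconnected) {f : ι → α}
    (hf : Function.Injective f) : (indexLabelling F f).IsFaithful where
  meets_of_eq := by
    rintro ⟨i, x⟩ ⟨i', y⟩ h
    obtain rfl : i = i' := hf h
    exact (hF i x y).map (semiconj_sigma_mk F i)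
  finite_range := (Set.finite_range f).subset (Set.range_comp_subset_range Sigma.fst f)

theorem isomorphic_fiber_indexLabelling (F : ι → UnarySystem.{u}) {f : ι → α}
    (hf : Function.Injective f) (i : ι) :
    Isomorphic (F i) ((indexLabelling F f).fiber (f i)) := by
  refine .of_bijective (Y := (indexLabelling F f).fiber (f i)) (j := fun x => ⟨⟨i, x⟩, rfl⟩)
    ⟨fun x y h => ?_, ?_⟩ fun _ => rfl
  · exact sigma_mk_injective (β := fun i => (F i).carrier) (congrArg Subtype.val h)
  · rintro ⟨⟨i', x⟩, h⟩
    obtain rfl : i' = i := hf h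
    exact ⟨x, rfl⟩

theorem isEmpty_fiber_indexLabelling (F : ι → UnarySystem.{u}) {f : ι → α} {k : α}
    (hk : k ∉ Set.range f) : IsEmpty ((indexLabelling F f).fiber k).carrier :=
  ⟨fun x => hk ⟨x.1.1, x.2⟩⟩

theorem exists_indexLabelling_eq (hG : ∀ j, (G j).IsPreconnected)
    (hne : ∀ j, Nonempty (G j).carrier) {q : (sigma G).Labelling α} (hq : q.IsFaithful) :
    ∃ τ : ι ↪ α, indexLabelling G τ = q := by
  let y₀ (j : ι) : (G j).carrier := (hne j).some
  refine ⟨⟨fun j => q ⟨j, y₀ j⟩, fun j j' h => ?_⟩, Labelling.ext (funext fun ⟨j, y⟩ => ?_)⟩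
  · exact (indexLabelling G id).eq_of_meets (hq.meets_of_eq _ _ h)
  · exact q.eq_of_meets ((hG j (y₀ j) y).map (semiconj_sigma_mk G j))

theorem exists_perm_sum_dist_le_sum_dist_fiber [Fintype ι] [DecidableEq α]
    (F G : ι → UnarySystem.{u}) (σ τ : ι ↪ α) :
    ∃ π : Equiv.Perm ι, ∑ i, dist (F i) (G (π i)) ≤
      ∑ k ∈ Finset.univ.map σ ∪ Finset.univ.map τ,
        dist ((indexLabelling F σ).fiber k) ((indexLabelling G τ).fiber k) := by
  obtain ⟨π, hπ⟩ := exists_perm_forall_mem_range_apply_eq σ τ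
  refine ⟨π, ?_⟩
  rw [sum_map_union_map hπ]
  refine Finset.sum_le_sum fun i _ => ?_
  have hF := isomorphic_fiber_indexLabelling F σ.injective i
  have hG := isomorphic_fiber_indexLabelling G τ.injective (π i)
  rw [hF.dist_congr hG]
  split_ifs with hi
  · rw [hi, add_zero]
  · have := isEmpty_fiber_indexLabelling G (mt (hπ i) hi)
    have := isEmpty_fiber_indexLabelling F ((apply_perm_mem_range_iff hπ i).not.2 hi)
    have hempty : Isomorphic ((indexLabelling G τ).fiber (σ i))
        ((indexLabelling F σ).fiber (τ (π i))) := .of_isEmpty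
    rw [← hempty.dist_congr (.refl _)]
    exact dist_triangle _ _ _

theorem dist_sigma_le_sum_dist_perm [Fintype ι] (F G : ι → UnarySystem.{u}) (π : Equiv.Perm ι) :
    dist (sigma F) (sigma G) ≤ ∑ i, dist (F i) (G (π i)) :=
  ((Isomorphic.refl _).dist_congr (sigma_comp_equiv_isomorphic G π)).symm.trans_le
    (dist_sigma_le F fun i => G (π i))

theorem exists_perm_sum_dist_le_of_path [Fintype ι] (hF : ∀ i, (F i).IsPreconnected)
    (hG : ∀ j, (G j).IsPreconnected) (hne : ∀ j, Nonempty (G j).carrier) {l : ℕ}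
    (h : Path (sigma F) (sigma G) l) : ∃ π : Equiv.Perm ι, ∑ i, dist (F i) (G (π i)) ≤ l := by
  classical
  let σ : ι ↪ ι ⊕ ℕ := .inl
  obtain ⟨q, hq, hle⟩ :=
    h.exists_labelling_sum_dist_fiber_le (isFaithful_indexLabelling hF σ.injective)
  obtain ⟨τ, rfl⟩ := exists_indexLabelling_eq hG hne hq
  obtain ⟨π, hπ⟩ := exists_perm_sum_dist_le_sum_dist_fiber F G σ τ
  exact ⟨π, hπ.trans (hle _)⟩

theorem isLeast_dist_sigma [Fintype ι] (hF : ∀ i, (F i).IsPreconnected)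
    (hG : ∀ j, (G j).IsPreconnected) (hne : ∀ j, Nonempty (G j).carrier) :
    IsLeast (Set.range fun π : Equiv.Perm ι => ∑ i, dist (F i) (G (π i)))
      (dist (sigma F) (sigma G)) := by
  obtain ⟨π, hπ⟩ := Finite.exists_min fun π : Equiv.Perm ι => ∑ i, dist (F i) (G (π i))
  refine ⟨⟨π, le_antisymm (le_iInf₂ fun l h => ?_) (dist_sigma_le_sum_dist_perm F G π)⟩, ?_⟩
  · obtain ⟨ρ, hρ⟩ := exists_perm_sum_dist_le_of_path hF hG hne h
    exact (hπ ρ).trans hρ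
  · rintro _ ⟨ρ, rfl⟩
    exact dist_sigma_le_sum_dist_perm F G ρ

end Index

/-! ### Generators -/

/-- The underlying set of the subsystem generated by `s`. -/
def closure (X : UnarySystem.{u}) (s : Set X.carrier) : Set X.carrier :=
  {y | ∃ x ∈ s, ∃ k : ℕ, X.op^[k] x = y}

theorem op_mem_closure {s : Set X.carrier} {y : X.carrier} (hy : y ∈ X.closure s) :
    X.op y ∈ X.closure s :=
  let ⟨x, hx, k, hk⟩ := hy
  ⟨x, hx, k + 1, by rw [Function.iterate_succ_apply', hk]⟩

theorem closure_mono {s t : Set X.carrier} (h : s ⊆ t) : X.closure s ⊆ X.closure t :=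
  fun _ ⟨x, hx, hk⟩ => ⟨x, h hx, hk⟩

theorem image_closure {j : X.carrier → Y.carrier} (hop : Semiconj j X.op Y.op) (s : Set X.carrier) :
    j '' X.closure s = Y.closure (j '' s) := by
  ext y
  constructor
  · rintro ⟨_, ⟨x, hx, k, rfl⟩, rfl⟩
    exact ⟨j x, ⟨x, hx, rfl⟩, k, (hop.iterate_right k x).symm⟩
  · rintro ⟨_, ⟨x, hx, rfl⟩, k, rfl⟩
    exact ⟨_, ⟨x, hx, k, rfl⟩, hop.iterate_right k x⟩

theorem Isomorphic.exists_closure_eq_univ (h : Isomorphic X Y) {s : Set X.carrier}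
    (hs : X.closure s = Set.univ) : ∃ t, Y.closure t = Set.univ ∧ t.encard ≤ s.encard := by
  obtain ⟨e, he⟩ := h
  refine ⟨e '' s, ?_, Set.encard_image_le e s⟩
  rw [← image_closure he, hs, Set.image_univ, e.range_eq_univ]

theorem EmbedsLargely.exists_closure_eq_univ (h : EmbedsLargely X Y) {s : Set X.carrier}
    (hs : X.closure s = Set.univ) : ∃ t, Y.closure t = Set.univ ∧ t.encard ≤ s.encard + 1 := by
  obtain ⟨j, b, hj⟩ := h
  refine ⟨insert b (j '' s), Set.eq_univ_of_forall fun y => ?_,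
    (Set.encard_insert_le _ _).trans (add_le_add_left (Set.encard_image_le j s) 1)⟩
  rcases hj.mem_range_or_iterate y with hy | ⟨k, hk⟩
  · rw [← Set.image_univ, ← hs, image_closure hj.semiconj] at hy
    exact closure_mono (Set.subset_insert _ _) hy
  · exact ⟨b, Set.mem_insert _ _, k, hk⟩

/-- The generator needed is the point at which the orbit of `b` first enters `X`. -/
theorem IsLargeEmbedding.exists_subsingleton_forall_mem_closure {j : X.carrier → Y.carrier}
    {b : Y.carrier} (h : IsLargeEmbedding j b) :
    ∃ t : Set X.carrier, t.Subsingleton ∧ ∀ k x, Y.op^[k] b = j x → x ∈ X.closure t := by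
  classical
  by_cases hent : ∃ (k : ℕ) (x : X.carrier), Y.op^[k] b = j x
  · obtain ⟨e, he⟩ := Nat.find_spec hent
    refine ⟨{e}, Set.subsingleton_singleton, fun k x hk => ⟨e, rfl, k - Nat.find hent, ?_⟩⟩
    refine h.injective ?_
    rw [h.semiconj.iterate_right, ← he, ← Function.iterate_add_apply,
      Nat.sub_add_cancel (Nat.find_min' hent ⟨x, hk⟩), hk]
  · exact ⟨∅, Set.subsingleton_empty, fun k x hk => (hent ⟨k, x, hk⟩).elim⟩

theorem EmbedsLargely.exists_closure_eq_univ_of_right (h : EmbedsLargely X Y) {s : Set Y.carrier}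
    (hs : Y.closure s = Set.univ) : ∃ t, X.closure t = Set.univ ∧ t.encard ≤ s.encard + 1 := by
  obtain ⟨j, b, hj⟩ := h
  obtain ⟨t, ht, hbt⟩ := hj.exists_subsingleton_forall_mem_closure
  have hcard : (j ⁻¹' s).encard ≤ s.encard := by
    rw [← hj.injective.encard_image]
    exact Set.encard_le_encard (Set.image_preimage_subset j s)
  refine ⟨j ⁻¹' s ∪ t, Set.eq_univ_of_forall fun x => ?_, (Set.encard_union_le _ _).trans
    (add_le_add hcard (Set.encard_le_one_iff_subsingleton.2 ht))⟩
  obtain ⟨y, hy, k, hk⟩ : j x ∈ Y.closure s := hs ▸ Set.mem_univ _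
  rcases hj.mem_range_or_iterate y with ⟨x', rfl⟩ | ⟨m, rfl⟩
  · exact ⟨x', Or.inl hy, k, hj.injective ((hj.semiconj.iterate_right k x').trans hk)⟩
  · rw [← Function.iterate_add_apply] at hk
    exact closure_mono Set.subset_union_right (hbt (k + m) x hk)

theorem Adjacent.exists_closure_eq_univ (h : Adjacent X Y) {s : Set X.carrier}
    (hs : X.closure s = Set.univ) : ∃ t, Y.closure t = Set.univ ∧ t.encard ≤ s.encard + 1 :=
  h.elim (·.exists_closure_eq_univ hs) (·.exists_closure_eq_univ_of_right hs)

theorem Path.exists_closure_eq_univ {l : ℕ} (h : Path X Y l) {s : Set X.carrier}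
    (hs : X.closure s = Set.univ) : ∃ t, Y.closure t = Set.univ ∧ t.encard ≤ s.encard + l := by
  induction h with
  | iso h => simpa using h.exists_closure_eq_univ hs
  | step _ hadj ih =>
    obtain ⟨t, ht, htl⟩ := ih
    obtain ⟨t', ht', htt'⟩ := hadj.exists_closure_eq_univ ht
    refine ⟨t', ht', htt'.trans ?_⟩
    rw [Nat.cast_succ, ← add_assoc]
    exact add_le_add_left htl 1

/-- The subsystem generated by a set. -/
def span (X : UnarySystem.{u}) (s : Set X.carrier) : UnarySystem.{u} where
  carrier := X.closure s
  op y := ⟨X.op y.1, op_mem_closure y.2⟩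

theorem span_isomorphic {s : Set X.carrier} (hs : X.closure s = Set.univ) :
    Isomorphic (X.span s) X :=
  .of_bijective (X := X.span s) (j := Subtype.val)
    ⟨Subtype.val_injective, fun y => ⟨⟨y, hs ▸ Set.mem_univ y⟩, rfl⟩⟩ fun _ => rfl

theorem span_embedsLargely_span_insert (X : UnarySystem.{u}) (s : Set X.carrier) (a : X.carrier) :
    EmbedsLargely (X.span s) (X.span (insert a s)) := by
  have hval : Semiconj Subtype.val (X.span (insert a s)).op X.op := fun _ => rfl
  have hmono : X.closure s ⊆ X.closure (insert a s) := closure_mono (Set.subset_insert a s)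
  refine ⟨Set.inclusion hmono, ⟨a, a, Set.mem_insert _ _, 0, rfl⟩, Set.inclusion_injective hmono,
    fun _ => rfl, ?_⟩
  rintro ⟨y, x, rfl | hx, k, rfl⟩
  · exact Or.inr ⟨k, Subtype.ext (hval.iterate_right k _)⟩
  · exact Or.inl ⟨⟨_, x, hx, k, rfl⟩, rfl⟩

theorem dist_span_le_of_isEmpty (E : UnarySystem.{u}) [IsEmpty E.carrier] (s : Set X.carrier) :
    dist E (X.span s) ≤ s.encard := by
  rcases s.finite_or_infinite with hs | hs
  · induction s, hs using Set.Finite.induction_on with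
    | empty =>
      have : IsEmpty (X.span ∅).carrier := ⟨fun ⟨_, _, h, _⟩ => h⟩
      simp [Isomorphic.of_isEmpty.dist_eq_zero]
    | @insert a s ha _ ih =>
      rw [Set.encard_insert_of_notMem ha]
      exact (dist_triangle E (X.span s) _).trans
        (add_le_add ih (Adjacent.dist_le_one (.inl (X.span_embedsLargely_span_insert s a))))
  · simp [hs.encard_eq]

theorem dist_of_isEmpty_left (E X : UnarySystem.{u}) [IsEmpty E.carrier] :
    dist E X = ⨅ (s : Set X.carrier) (_ : X.closure s = Set.univ), s.encard := by
  refine le_antisymm (le_iInf₂ fun s hs => ?_) (le_iInf₂ fun l h => ?_)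
  · rw [← (Isomorphic.refl E).dist_congr (span_isomorphic hs)]
    exact dist_span_le_of_isEmpty E s
  · obtain ⟨t, ht, htl⟩ := h.exists_closure_eq_univ (Subsingleton.elim (E.closure ∅) _)
    exact (iInf₂_le t ht).trans (by simpa using htl)

end UnarySystem

namespace MonounaryAlgebra

open UnarySystem (Adjacent EmbedsLargely Path)

/-- A monounary algebra, viewed as a possibly empty one. -/
def toUnarySystem (A : MonounaryAlgebra.{u}) : UnarySystem.{u} := ⟨A.carrier, A.op⟩

/-- A nonempty unary system, viewed as a monounary algebra. -/
def ofUnarySystem (X : UnarySystem.{u}) [h : Nonempty X.carrier] : MonounaryAlgebra.{u} :=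
  ⟨X.carrier, h, X.op⟩

instance (A : MonounaryAlgebra.{u}) : Nonempty A.toUnarySystem.carrier := A.nonempty_carrier

variable {A B C : MonounaryAlgebra.{u}}

theorem gen_eq_closure (A : MonounaryAlgebra.{u}) (S : Set A.carrier) :
    A.gen S = A.toUnarySystem.closure S := by
  refine Set.Subset.antisymm (Set.sInter_subset_of_mem ⟨fun x hx => ⟨x, hx, 0, rfl⟩,
    fun _ => UnarySystem.op_mem_closure⟩) ?_
  rintro _ ⟨x, hx, k, rfl⟩ T ⟨hST, hT⟩
  exact Set.MapsTo.iterate hT k (hST hx)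

theorem IsLargeSubalgebra.embedsLargely (h : IsLargeSubalgebra A B) :
    EmbedsLargely A.toUnarySystem B.toUnarySystem := by
  obtain ⟨S, hne, hS, rfl, b, hb⟩ := h
  refine ⟨Subtype.val, b, Subtype.val_injective, fun _ => rfl, fun y => ?_⟩
  obtain ⟨x, hx | rfl, k, hk⟩ : y ∈ B.toUnarySystem.closure (S ∪ {b}) :=
    (gen_eq_closure B _).le (hb.ge (Set.mem_univ y))
  · exact Or.inl ⟨⟨y, hk ▸ Set.MapsTo.iterate hS k hx⟩, rfl⟩
  · exact Or.inr ⟨k, hk⟩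

theorem exists_isLargeSubalgebra_of_embedsLargely
    (h : EmbedsLargely A.toUnarySystem B.toUnarySystem) :
    ∃ C, Isomorphic A C ∧ IsLargeSubalgebra C B := by
  obtain ⟨j, b, hj⟩ := h
  have hne : (Set.range j).Nonempty := Set.range_nonempty j
  have hS : B.IsClosedSet (Set.range j) := by
    rintro _ ⟨x, rfl⟩
    exact ⟨A.op x, hj.semiconj x⟩
  refine ⟨B.restrict (Set.range j) hne hS, ⟨Equiv.ofInjective j hj.injective,
    fun x => Subtype.ext (hj.semiconj x)⟩, _, hne, hS, rfl, b, ?_⟩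
  rw [gen_eq_closure]
  refine Set.eq_univ_of_forall fun y => ?_
  rcases hj.mem_range_or_iterate y with hy | hy
  exacts [⟨y, Or.inl hy, 0, rfl⟩, ⟨b, Or.inr rfl, hy⟩]

theorem Isomorphic.toUnarySystem (h : A.Isomorphic B) :
    UnarySystem.Isomorphic A.toUnarySystem B.toUnarySystem :=
  h

theorem Isomorphic.symm (h : A.Isomorphic B) : B.Isomorphic A :=
  h.toUnarySystem.symm

namespace HasPath

theorem adjacent {l : ℕ} (h : HasPath A B l)
    (hadj : Adjacent B.toUnarySystem C.toUnarySystem) : HasPath A C (l + 1) := by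
  rcases hadj with hBC | hCB
  · obtain ⟨D, hD, hDC⟩ := exists_isLargeSubalgebra_of_embedsLargely hBC
    exact (h.red hD).blue (Or.inl hDC)
  · obtain ⟨D, hD, hDB⟩ := exists_isLargeSubalgebra_of_embedsLargely hCB
    exact (h.blue (Or.inr hDB)).red hD.symm

theorem trans {k l : ℕ} (h : HasPath A B k) (h' : HasPath B C l) : HasPath A C (k + l) := by
  induction h' with
  | nil => exact h
  | red _ e ih => exact ih.red e
  | blue _ e ih => exact ih.blue e

theorem path {l : ℕ} (h : HasPath A B l) : Path A.toUnarySystem B.toUnarySystem l := by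
  induction h with
  | nil => exact .iso (.refl _)
  | red _ e ih => exact ih.trans_isomorphic e.toUnarySystem
  | blue _ e ih => exact .step ih (e.imp (·.embedsLargely) (·.embedsLargely))

end HasPath

theorem hasPath_sum_of_path {X Y : UnarySystem.{u}} {l : ℕ} (h : Path X Y l)
    (W : UnarySystem.{u}) [Nonempty W.carrier] :
    HasPath (ofUnarySystem (X.sum W)) (ofUnarySystem (Y.sum W)) l := by
  induction h with
  | iso h => exact .red .nil (h.sum_right W)
  | step _ hadj ih => exact ih.adjacent (hadj.sum_right W)

theorem hasPath_of_path_isEmpty {E : UnarySystem.{u}} [IsEmpty E.carrier] {k l : ℕ}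
    (hA : Path A.toUnarySystem E k) (hB : Path E B.toUnarySystem l) : HasPath A B (k + l) := by
  have hEA : Isomorphic (ofUnarySystem (E.sum A.toUnarySystem)) A :=
    UnarySystem.isEmpty_sum_isomorphic E _
  have hEB : Isomorphic (ofUnarySystem (E.sum B.toUnarySystem)) B :=
    UnarySystem.isEmpty_sum_isomorphic E _
  have hcomm : Isomorphic (ofUnarySystem (B.toUnarySystem.sum A.toUnarySystem))
      (ofUnarySystem (A.toUnarySystem.sum B.toUnarySystem)) :=
    UnarySystem.sum_isomorphic_comm _ _
  have hAB := ((HasPath.nil.red hEA.symm).trans (hasPath_sum_of_path hB A.toUnarySystem)).red hcomm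
  rw [add_comm k, ← Nat.zero_add l]
  exact (hAB.trans (hasPath_sum_of_path hA B.toUnarySystem)).red hEB

theorem hasPath_or_exists_isEmpty_of_path {Y : UnarySystem.{u}} {l : ℕ}
    (h : Path A.toUnarySystem Y l) :
    (∃ _ : Nonempty Y.carrier, HasPath A (ofUnarySystem Y) l) ∨
      ∃ (E : UnarySystem.{u}) (a b : ℕ), IsEmpty E.carrier ∧ Path A.toUnarySystem E a ∧
        Path E Y b ∧ a + b = l := by
  induction h with
  | iso h => exact Or.inl ⟨A.nonempty_carrier.map h.choose, .red .nil h⟩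
  | @step Y Z l h hadj ih =>
    rcases isEmpty_or_nonempty Z.carrier with hZ | hZ
    · exact Or.inr ⟨Z, l + 1, 0, hZ, .step h hadj, .iso (.refl Z), rfl⟩
    · rcases ih with ⟨_, hAY⟩ | ⟨E, a, b, hE, ha, hb, rfl⟩
      · exact Or.inl ⟨hZ, hAY.adjacent hadj⟩
      · exact Or.inr ⟨E, a, b + 1, hE, ha, .step hb hadj, rfl⟩

theorem hasPath_of_path {l : ℕ} (h : Path A.toUnarySystem B.toUnarySystem l) :
    HasPath A B l := by
  rcases hasPath_or_exists_isEmpty_of_path h with ⟨_, hAB⟩ | ⟨E, a, b, _, ha, hb, rfl⟩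
  exacts [hAB, hasPath_of_path_isEmpty ha hb]

theorem dist_toUnarySystem (A B : MonounaryAlgebra.{u}) :
    UnarySystem.dist A.toUnarySystem B.toUnarySystem = A.dist B :=
  le_antisymm (le_iInf₂ fun _ h => h.path.dist_le)
    (le_iInf₂ fun l h => iInf₂_le l (hasPath_of_path h))

theorem dist_toUnarySystem_of_isEmpty_left (E : UnarySystem.{u}) [IsEmpty E.carrier]
    (A : MonounaryAlgebra.{u}) : UnarySystem.dist E A.toUnarySystem = A.MGen := by
  simp only [UnarySystem.dist_of_isEmpty_left, MGen, gen_eq_closure]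
  rfl

section Padding

variable {ι κ : Type}

/-- The family `F`, transported along `f` and extended by empty systems to the index type `κ`. -/
def pad (F : ι → MonounaryAlgebra.{u}) (f : ι → κ) : κ → UnarySystem.{u} :=
  (UnarySystem.indexLabelling (fun i => (F i).toUnarySystem) f).fiber

theorem isomorphic_pad (F : ι → MonounaryAlgebra.{u}) {f : ι → κ} (hf : Function.Injective f)
    (i : ι) : UnarySystem.Isomorphic (F i).toUnarySystem (pad F f (f i)) :=
  UnarySystem.isomorphic_fiber_indexLabelling (fun i => (F i).toUnarySystem) hf i

theorem isPreconnected_pad [Finite ι] {F : ι → MonounaryAlgebra.{u}}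
    (hF : ∀ i, (F i).IsConnected) {f : ι → κ} (hf : Function.Injective f) (k : κ) :
    (pad F f k).IsPreconnected :=
  (UnarySystem.isFaithful_indexLabelling (F := fun i => (F i).toUnarySystem)
    hF hf).isPreconnected_fiber k

theorem sigma_pad_isomorphic [Nonempty ι] (F : ι → MonounaryAlgebra.{u}) (f : ι → κ) :
    UnarySystem.Isomorphic (UnarySystem.sigma (pad F f)) (disjointUnion F).toUnarySystem :=
  UnarySystem.Labelling.sigma_fiber_isomorphic _

theorem sum_dist_pad [Fintype ι] [Fintype κ] (F : ι → MonounaryAlgebra.{u})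
    (G : κ → MonounaryAlgebra.{u}) (f : ι ↪ κ) [DecidablePred (· ∈ Set.range f)] :
    ∑ k, UnarySystem.dist (pad F f k) (G k).toUnarySystem =
      (∑ i, (F i).dist (G (f i))) + ∑ k with k ∉ Set.range f, (G k).MGen := by
  have hrange : (Finset.univ.filter fun k => k ∈ Set.range f) = Finset.univ.map f := by
    ext k; simp
  rw [← Finset.sum_filter_add_sum_filter_not Finset.univ fun k => k ∈ Set.range f, hrange,
    Finset.sum_map]
  congr 1
  · refine Finset.sum_congr rfl fun i _ => ?_
    rw [← dist_toUnarySystem]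
    exact ((isomorphic_pad F f.injective i).dist_congr (.refl _)).symm
  · refine Finset.sum_congr rfl fun k hk => ?_
    have : IsEmpty (pad F f k).carrier :=
      UnarySystem.isEmpty_fiber_indexLabelling _ (Finset.mem_filter.1 hk).2
    exact dist_toUnarySystem_of_isEmpty_left _ _

end Padding

end MonounaryAlgebra

theorem mainTheorem1 {n m : ℕ} [NeZero n] [NeZero m] (hnm : n ≤ m)
    (A B : MonounaryAlgebra.{u})
    (As : Fin n → MonounaryAlgebra.{u}) (Bs : Fin m → MonounaryAlgebra.{u})
    (hAs : ∀ i, (As i).IsConnected) (hBs : ∀ j, (Bs j).IsConnected)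
    (hA : A.Isomorphic (MonounaryAlgebra.disjointUnion As))
    (hB : B.Isomorphic (MonounaryAlgebra.disjointUnion Bs)) :
    IsLeast
      (Set.range fun π : Equiv.Perm (Fin m) =>
        (∑ i : Fin n, (As i).dist (Bs (π (Fin.castLE hnm i)))) +
          ∑ k ∈ Finset.univ.filter (fun k : Fin m => n ≤ k.val), (Bs (π k)).MGen)
      (A.dist B) := by
  classical
  let f : Fin n ↪ Fin m := Fin.castLEEmb hnm
  have hrange (k : Fin m) : k ∉ Set.range f ↔ n ≤ k.val := by
    simp only [f, Fin.coe_castLEEmb, Fin.range_castLE, Set.mem_ofPred_eq, not_lt]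
  have hsum (π : Equiv.Perm (Fin m)) :=
    MonounaryAlgebra.sum_dist_pad As (fun k => Bs (π k)) f
  have hdist : UnarySystem.dist (UnarySystem.sigma (MonounaryAlgebra.pad As f))
      (UnarySystem.sigma fun j => (Bs j).toUnarySystem) = A.dist B := by
    rw [← MonounaryAlgebra.dist_toUnarySystem]
    exact ((MonounaryAlgebra.sigma_pad_isomorphic As f).trans hA.toUnarySystem.symm).dist_congr
      hB.toUnarySystem.symm
  have key := UnarySystem.isLeast_dist_sigma (MonounaryAlgebra.isPreconnected_pad hAs f.injective)
    (G := fun j => (Bs j).toUnarySystem) hBs fun j => (Bs j).nonempty_carrier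
  simp only [hsum, hrange, hdist] at key
  exact key
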